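/- For a finite word $w$, let $|w|_{\mathrm{pal}}$ denote the minimal number $k$ of palindromes $p_1,\dots,p_k$ such that $w=p_1p_2\cdots p_k$. For an infinite word $\boldsymbol{u}=u_0u_1u_2\cdots$ let $$\mathrm{PL}_{\boldsymbol{u}}(n)=\max\{|v|_{\mathrm{pal}} : v \text{ is a factor of length } n \text{ of } \boldsymbol{u}\}.$$ An infinite word over the alphabet $\{0,1\}$ is called Sturmian if it has exactly $n+1$ distinct factors of length $n$ for every $n\ge 0$. Theorem. Let $f:\mathbb{N}\to\mathbb{R}$ be a non-decreasing function with $\lim_{n\to\infty}f(n)=+\infty$. Then there is a Sturmian word $\boldsymbol{u}$ such that $\mathrm{PL}_{\boldsymbol{u}}(n)=o(f(n))$ as $n\to\infty$. -/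

import Mathlib

open Filter Asymptotics

/-- `palLength w` is the minimal number of palindromes whose concatenation is `w`
(so `palLength [] = 0`). -/
noncomputable def palLength {A : Type*} (w : List A) : ℕ :=
  sInf {k : ℕ | ∃ ps : List (List A), ps.length = k ∧ (∀ p ∈ ps, p.Palindrome) ∧ ps.flatten = w}

/-- The word `u i, u (i + 1), …, u (i + n - 1)` of length `n`. -/
def factorAt {A : Type*} (u : ℕ → A) (i n : ℕ) : List A :=
  List.ofFn fun j : Fin n => u (i + j)

/-- The set of all factors of length `n` of the infinite word `u`. -/
def factorsOfLength {A : Type*} (u : ℕ → A) (n : ℕ) : Set (List A) :=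
  {v | ∃ i : ℕ, v = factorAt u i n}

/-- A Sturmian word: an infinite word over the alphabet `{0, 1}` that has exactly `n + 1` factors
of length `n`, for every `n ≥ 0`. -/
def IsSturmian (u : ℕ → Fin 2) : Prop :=
  ∀ n : ℕ, (factorsOfLength u n).ncard = n + 1

/-- `PL u n` is the maximal palindromic length of the factors of length `n` of `u`. -/
noncomputable def PL {A : Type*} (u : ℕ → A) (n : ℕ) : ℕ :=
  sSup (palLength '' factorsOfLength u n)

theorem palLength_le_length {A : Type*} (w : List A) : palLength w ≤ w.length := by
  refine Nat.sInf_le ⟨w.map fun a => [a], by simp, ?_, ?_⟩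
  · intro p hp
    obtain ⟨a, -, rfl⟩ := List.mem_map.1 hp
    exact List.Palindrome.singleton a
  · induction w with
    | nil => rfl
    | cons a w ih => simpa using ih

/-- The supremum in the definition of `PL` is a maximum. -/
theorem isGreatest_PL {A : Type*} (u : ℕ → A) (n : ℕ) :
    IsGreatest (palLength '' factorsOfLength u n) (PL u n) := by
  have hb : BddAbove (palLength '' factorsOfLength u n) := by
    refine ⟨n, ?_⟩
    rintro _ ⟨_, ⟨i, rfl⟩, rfl⟩
    simpa [factorAt] using palLength_le_length (factorAt u i n)
  have hn : (palLength '' factorsOfLength u n).Nonempty := ⟨_, _, ⟨0, rfl⟩, rfl⟩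
  exact ⟨Nat.sSup_mem hn hb, fun _ h => le_csSup hb h⟩

/-!
The word is the mechanical word `⌊(i + 1) α⌋ - ⌊i α⌋` of an irrational slope `α` that is extremely
well approximated by rationals `p n / b n`.

It is Sturmian (`isSturmian_mechanicalWord`) because the factor of length `n` starting at `i` is
determined by which of the `n` distinct thresholds `1 - fract (j α)`, `1 ≤ j ≤ n`, lie below
`fract (i α)`; the points `fract (i α)` being dense, all `n + 1` lower sections occur.

Its palindromic length is controlled as follows. On a window of length at most `Q n`, where
`0 ≤ α - p n / b n ≤ 1 / (b n * Q n)`, the word agrees, up to one change of phase, with a word of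
period `b n` and rational slope `p n / b n`. The latter is symmetric under a reflection in each
period, so the window is cut into two long palindromes and a bounded number of remainders of length
at most `b n` (`palLength_factorAt_le_of_approx`). A remainder of length
`b n = 2 * b (n - 1) * Q (n - 1)` splits into `2 * b (n - 1)` windows of length at most `Q (n - 1)`,
each of which has palindromic length `O(b (n - 1))` by the same result. Hence all factors of length
at most `Q n` have palindromic length bounded by a function of `b (n - 1)` alone. Since `Q (n - 1)`
may be chosen after `b (n - 1)`, it can be made so large that `f` exceeds `n` times this bound from
`Q (n - 1)` on (`exists_fast_approximable_slope`).
-/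

/-! ### Mechanical words -/

/-- The lower mechanical word of slope `α` and intercept `0`: its `i`-th letter is the increment
`⌊(i + 1) α⌋ - ⌊i α⌋`, which lies in `{0, 1}` when `0 ≤ α ≤ 1`. -/
noncomputable def mechanicalWord (α : ℝ) (i : ℕ) : Fin 2 :=
  if ⌊((i + 1 : ℕ) : ℝ) * α⌋ = ⌊(i : ℝ) * α⌋ then 0 else 1

theorem floor_succ_mul_eq {α : ℝ} (h0 : 0 < α) (h1 : α < 1) (i : ℕ) :
    ⌊((i + 1 : ℕ) : ℝ) * α⌋ = ⌊(i : ℝ) * α⌋ + ((mechanicalWord α i : ℕ) : ℤ) := by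
  have hle : ⌊(i : ℝ) * α⌋ ≤ ⌊((i + 1 : ℕ) : ℝ) * α⌋ := by
    apply Int.floor_le_floor
    push_cast
    nlinarith
  have hlt : ⌊((i + 1 : ℕ) : ℝ) * α⌋ ≤ ⌊(i : ℝ) * α⌋ + 1 := by
    rw [← Int.floor_add_one]
    apply Int.floor_le_floor
    push_cast
    nlinarith
  unfold mechanicalWord
  split_ifs with h
  · simpa using h
  · have h' : (((1 : Fin 2) : ℕ) : ℤ) = 1 := rfl
    rw [h']
    omega

theorem mechanicalWord_eq_of_increment_eq {α : ℝ} (h0 : 0 < α) (h1 : α < 1) {i j : ℕ}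
    (h : ⌊((i + 1 : ℕ) : ℝ) * α⌋ - ⌊(i : ℝ) * α⌋ = ⌊((j + 1 : ℕ) : ℝ) * α⌋ - ⌊(j : ℝ) * α⌋) :
    mechanicalWord α i = mechanicalWord α j := by
  rw [floor_succ_mul_eq h0 h1, floor_succ_mul_eq h0 h1] at h
  apply Fin.ext
  omega

theorem factorAt_eq_factorAt_iff {A : Type*} {u : ℕ → A} {i i' n : ℕ} :
    factorAt u i n = factorAt u i' n ↔ ∀ j < n, u (i + j) = u (i' + j) := by
  unfold factorAt
  rw [List.ofFn_inj, funext_iff]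
  exact ⟨fun h j hj => h ⟨j, hj⟩, fun h j => h j j.2⟩

theorem factorAt_mechanicalWord_eq_iff {α : ℝ} (h0 : 0 < α) (h1 : α < 1) {i i' n : ℕ} :
    factorAt (mechanicalWord α) i n = factorAt (mechanicalWord α) i' n ↔
      ∀ j ≤ n, ⌊((i + j : ℕ) : ℝ) * α⌋ - ⌊(i : ℝ) * α⌋ =
        ⌊((i' + j : ℕ) : ℝ) * α⌋ - ⌊(i' : ℝ) * α⌋ := by
  rw [factorAt_eq_factorAt_iff]
  constructor
  · intro h j
    induction j with
    | zero => simp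
    | succ j ih =>
      intro hj
      have := ih (by omega)
      have h2 := h j (by omega)
      rw [← add_assoc, ← add_assoc, floor_succ_mul_eq h0 h1, floor_succ_mul_eq h0 h1, h2]
      omega
  · intro h j hj
    apply mechanicalWord_eq_of_increment_eq h0 h1
    have a := h j hj.le
    have b := h (j + 1) hj
    rw [← add_assoc, ← add_assoc] at b
    omega

/-! ### Irrational mechanical words are Sturmian -/

/-- As `j` varies, the increment `⌊(i + j) α⌋ - ⌊i α⌋` depends on `i` only through the comparison
of `fract (i α)` with the thresholds `1 - fract (j α)`. -/
theorem floor_add_mul_sub_floor (α : ℝ) (i j : ℕ) :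
    ⌊((i + j : ℕ) : ℝ) * α⌋ - ⌊(i : ℝ) * α⌋ =
      ⌊(j : ℝ) * α⌋ + if 1 - Int.fract ((j : ℝ) * α) ≤ Int.fract ((i : ℝ) * α) then 1 else 0 := by
  have e : ((i + j : ℕ) : ℝ) * α = i * α + j * α := by push_cast; ring
  rw [e, sub_eq_iff_eq_add, Int.floor_eq_iff]
  have a := Int.fract_add_floor ((i : ℝ) * α)
  have b := Int.fract_add_floor ((j : ℝ) * α)
  have a1 := Int.fract_lt_one ((i : ℝ) * α)
  have b1 := Int.fract_lt_one ((j : ℝ) * α)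
  have a0 := Int.fract_nonneg ((i : ℝ) * α)
  have b0 := Int.fract_nonneg ((j : ℝ) * α)
  split_ifs with h <;> push_cast <;> constructor <;> linarith

/-- The nonnegative multiples of an irrational number are dense modulo one. -/
theorem exists_fract_mul_mem_Ioo {α : ℝ} (hα : Irrational α) {a b : ℝ} (ha : 0 ≤ a) (hab : a < b)
    (hb : b ≤ 1) : ∃ i : ℕ, Int.fract ((i : ℝ) * α) ∈ Set.Ioo a b := by
  have hd : DenseRange (· • (α : AddCircle (1 : ℝ)) : ℕ → AddCircle (1 : ℝ)) := by
    rw [← denseRange_zsmul_iff_nsmul, AddCircle.denseRange_zsmul_coe_iff]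
    simpa using hα
  have ho : IsOpen ((fun x : ℝ => (x : AddCircle (1 : ℝ))) '' Set.Ioo a b) :=
    QuotientAddGroup.isOpenMap_coe _ isOpen_Ioo
  obtain ⟨i, x, hx, hi⟩ := hd.exists_mem_open ho ((Set.nonempty_Ioo.2 hab).image _)
  refine ⟨i, ?_⟩
  have hi' : (x : AddCircle (1 : ℝ)) = ((Int.fract ((i : ℝ) * α) : ℝ) : AddCircle (1 : ℝ)) := by
    rw [AddCircle.coe_fract]
    simpa using hi
  have : Fact ((0 : ℝ) < 1) := ⟨one_pos⟩
  rw [AddCircle.coe_eq_coe_iff_of_mem_Ico (a := 0)] at hi'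
  · rwa [← hi']
  · exact ⟨ha.trans hx.1.le, by linarith [hx.2]⟩
  · exact ⟨Int.fract_nonneg _, by simpa using Int.fract_lt_one _⟩

/-- The terms below `b` of a sequence dense in `[0, 1]` cut out exactly `#T + 1` lower sections of
a finite set `T ⊆ (0, b)`. The bound `b` lets the induction remove the maximum of `T`. -/
theorem ncard_lower_sections (X : ℕ → ℝ)
    (hX : ∀ a b : ℝ, 0 ≤ a → a < b → b ≤ 1 → ∃ i, X i ∈ Set.Ioo a b) (T : Finset ℝ) :
    ∀ b : ℝ, 0 < b → b ≤ 1 → (∀ t ∈ T, t ∈ Set.Ioo 0 b) →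
      {A : Finset ℝ | ∃ i, X i < b ∧ A = T.filter (· ≤ X i)}.ncard = T.card + 1 := by
  induction T using Finset.induction_on_max with
  | empty =>
    intro b hb hb1 _
    obtain ⟨i, hi⟩ := hX 0 b le_rfl hb hb1
    have : {A : Finset ℝ | ∃ i, X i < b ∧ A = (∅ : Finset ℝ).filter (· ≤ X i)} = {∅} := by
      ext A
      simp only [Finset.filter_empty, Set.mem_ofPred_eq, Set.mem_singleton_iff]
      exact ⟨fun ⟨_, _, h⟩ => h, fun h => ⟨i, hi.2, h⟩⟩
    rw [this, Set.ncard_singleton, Finset.card_empty]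
  | insert a T hT ih =>
    intro b hb hb1 hTb
    have ha := hTb a (Finset.mem_insert_self _ _)
    have haT : a ∉ T := fun h => lt_irrefl _ (hT a h)
    have ih' := ih a ha.1 (ha.2.le.trans hb1) fun t ht =>
      ⟨(hTb t (Finset.mem_insert_of_mem ht)).1, hT t ht⟩
    have key : {A : Finset ℝ | ∃ i, X i < b ∧ A = (insert a T).filter (· ≤ X i)} =
        insert (insert a T) {A : Finset ℝ | ∃ i, X i < a ∧ A = T.filter (· ≤ X i)} := by
      ext A
      simp only [Set.mem_ofPred_eq, Set.mem_insert_iff]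
      constructor
      · rintro ⟨i, hi, rfl⟩
        by_cases h : X i < a
        · exact Or.inr ⟨i, h, by rw [Finset.filter_insert, if_neg (not_le.2 h)]⟩
        · left
          rw [Finset.filter_eq_self]
          intro t ht
          rcases Finset.mem_insert.1 ht with rfl | ht
          · exact not_lt.1 h
          · exact (hT t ht).le.trans (not_lt.1 h)
      · rintro (rfl | ⟨i, hi, rfl⟩)
        · obtain ⟨i, hi⟩ := hX a b ha.1.le ha.2 hb1
          refine ⟨i, hi.2, ?_⟩
          rw [Finset.filter_eq_self.2]
          intro t ht
          rcases Finset.mem_insert.1 ht with rfl | ht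
          · exact hi.1.le
          · exact ((hT t ht).trans hi.1).le
        · exact ⟨i, hi.trans ha.2, by rw [Finset.filter_insert, if_neg (not_le.2 hi)]⟩
    have hfin : {A : Finset ℝ | ∃ i, X i < a ∧ A = T.filter (· ≤ X i)}.Finite := by
      refine T.powerset.finite_toSet.subset ?_
      rintro _ ⟨i, -, rfl⟩
      exact Finset.mem_powerset.2 (Finset.filter_subset _ _)
    rw [key, Set.ncard_insert_of_notMem ?_ hfin, ih', Finset.card_insert_of_notMem haT]
    rintro ⟨i, -, h⟩
    have : a ∈ T.filter (· ≤ X i) := h ▸ Finset.mem_insert_self a T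
    exact haT (Finset.mem_filter.1 this).1

theorem ncard_range_eq_of_ker_eq {ι β γ : Type*} {g : ι → β} {h : ι → γ}
    (H : ∀ i j, g i = g j ↔ h i = h j) : (Set.range g).ncard = (Set.range h).ncard := by
  have hk : Setoid.ker g = Setoid.ker h := Setoid.ext H
  have e1 := Nat.card_congr (Setoid.quotientKerEquivRange g)
  have e2 := Nat.card_congr (Setoid.quotientKerEquivRange h)
  rw [← Nat.card_coe_set_eq, ← Nat.card_coe_set_eq, ← e1, ← e2, hk]

theorem isSturmian_mechanicalWord {α : ℝ} (hα : Irrational α) (h0 : 0 < α) (h1 : α < 1) :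
    IsSturmian (mechanicalWord α) := by
  intro n
  let θ : ℕ → ℝ := fun j => 1 - Int.fract ((j : ℝ) * α)
  let X : ℕ → ℝ := fun i => Int.fract ((i : ℝ) * α)
  let T : Finset ℝ := (Finset.Icc 1 n).image θ
  have hθ : Function.Injective θ := by
    intro j k hjk
    have h : Int.fract ((j : ℝ) * α) = Int.fract ((k : ℝ) * α) := by
      simpa [θ] using hjk
    obtain ⟨z, hz⟩ := Int.fract_eq_fract.1 h
    by_contra hne
    have hne' : ((j : ℤ) - k) ≠ 0 := by omega
    apply (hα.intCast_mul hne').ne_int z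
    push_cast
    linarith
  have hcard : T.card = n := by
    rw [Finset.card_image_of_injective _ hθ]
    simp
  have hT : ∀ t ∈ T, t ∈ Set.Ioo (0 : ℝ) 1 := by
    intro t ht
    obtain ⟨j, hj, rfl⟩ := Finset.mem_image.1 ht
    have hj0 : j ≠ 0 := by have := (Finset.mem_Icc.1 hj).1; omega
    have hpos : 0 < Int.fract ((j : ℝ) * α) := Int.fract_pos.2 ((hα.natCast_mul hj0).ne_int _)
    have := Int.fract_lt_one ((j : ℝ) * α)
    constructor <;> simp only [θ] <;> linarith
  have hS := ncard_lower_sections X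
    (fun a b ha hab hb => exists_fract_mul_mem_Ioo hα ha hab hb) T 1 one_pos le_rfl hT
  have e1 : factorsOfLength (mechanicalWord α) n =
      Set.range fun i => factorAt (mechanicalWord α) i n := by
    ext v
    exact ⟨fun ⟨i, h⟩ => ⟨i, h.symm⟩, fun ⟨i, h⟩ => ⟨i, h.symm⟩⟩
  have e2 : {A : Finset ℝ | ∃ i, X i < 1 ∧ A = T.filter (· ≤ X i)} =
      Set.range fun i => T.filter (· ≤ X i) := by
    ext A
    exact ⟨fun ⟨i, _, h⟩ => ⟨i, h.symm⟩, fun ⟨i, h⟩ => ⟨i, Int.fract_lt_one _, h.symm⟩⟩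
  rw [← hcard, ← hS, hcard, e1, e2]
  apply ncard_range_eq_of_ker_eq
  intro i i'
  rw [factorAt_mechanicalWord_eq_iff h0 h1]
  simp only [floor_add_mul_sub_floor, add_right_inj, Finset.ext_iff, Finset.mem_filter,
    and_congr_right_iff]
  constructor
  · intro h t ht
    obtain ⟨j, hj, rfl⟩ := Finset.mem_image.1 ht
    have := h j (Finset.mem_Icc.1 hj).2
    simp only [θ, X]
    split_ifs at this with c1 c2 c2
    · exact iff_of_true c1 c2
    · simp at this
    · simp at this
    · exact iff_of_false c1 c2
  · intro h j hj
    rcases Nat.eq_zero_or_pos j with rfl | hj0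
    · have e : ∀ x : ℝ, ¬ (1 : ℝ) ≤ Int.fract x := fun x => not_le.2 (Int.fract_lt_one x)
      simp [e]
    · have := h (θ j) (Finset.mem_image_of_mem _ (Finset.mem_Icc.2 ⟨hj0, hj⟩))
      simp only [θ, X] at this
      simp only [this]

/-! ### Palindromic length of factors -/

theorem exists_palindromes_of_palLength {A : Type*} (w : List A) :
    ∃ ps : List (List A), ps.length = palLength w ∧ (∀ p ∈ ps, p.Palindrome) ∧ ps.flatten = w := by
  refine Nat.sInf_mem (s := {k : ℕ | ∃ ps : List (List A), ps.length = k ∧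
    (∀ p ∈ ps, p.Palindrome) ∧ ps.flatten = w}) ⟨_, w.map fun a => [a], rfl, ?_, ?_⟩
  · intro p hp
    obtain ⟨a, -, rfl⟩ := List.mem_map.1 hp
    exact List.Palindrome.singleton a
  · induction w with
    | nil => rfl
    | cons a w ih => simpa using ih

theorem palLength_append_le {A : Type*} (v w : List A) :
    palLength (v ++ w) ≤ palLength v + palLength w := by
  obtain ⟨ps, h1, h2, h3⟩ := exists_palindromes_of_palLength v
  obtain ⟨qs, k1, k2, k3⟩ := exists_palindromes_of_palLength w
  refine Nat.sInf_le ⟨ps ++ qs, by simp [h1, k1], ?_, by simp [h3, k3]⟩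
  intro p hp
  rcases List.mem_append.1 hp with hp | hp
  exacts [h2 p hp, k2 p hp]

theorem palLength_le_one_of_palindrome {A : Type*} {w : List A} (h : w.Palindrome) :
    palLength w ≤ 1 :=
  Nat.sInf_le ⟨[w], by simp, by simpa using h, by simp⟩

theorem length_factorAt {A : Type*} (u : ℕ → A) (i n : ℕ) : (factorAt u i n).length = n := by
  simp [factorAt]

theorem factorAt_add {A : Type*} (u : ℕ → A) (i m n : ℕ) :
    factorAt u i (m + n) = factorAt u i m ++ factorAt u (i + m) n := by
  simp [factorAt, List.ofFn_add, add_assoc]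

theorem palLength_factorAt_le {A : Type*} (u : ℕ → A) (i n : ℕ) :
    palLength (factorAt u i n) ≤ n := by
  simpa [length_factorAt] using palLength_le_length (factorAt u i n)

theorem palLength_factorAt_add_le {A : Type*} (u : ℕ → A) (i m n : ℕ) :
    palLength (factorAt u i (m + n)) ≤
      palLength (factorAt u i m) + palLength (factorAt u (i + m) n) := by
  rw [factorAt_add]
  exact palLength_append_le _ _

/-- A bound for the factors of length at most `L` multiplies by `k` for those of length at most
`k * L`. -/
theorem palLength_factorAt_le_mul {A : Type*} {u : ℕ → A} {L D : ℕ}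
    (h : ∀ i n, n ≤ L → palLength (factorAt u i n) ≤ D) (k : ℕ) :
    ∀ i n, n ≤ k * L → palLength (factorAt u i n) ≤ k * D := by
  induction k with
  | zero =>
    intro i n hn
    exact (palLength_factorAt_le u i n).trans (by simpa using hn)
  | succ k ih =>
    intro i n hn
    rw [add_mul, one_mul] at hn ⊢
    obtain ⟨a, b, rfl, ha, hb⟩ : ∃ a b, n = a + b ∧ a ≤ k * L ∧ b ≤ L :=
      ⟨min n (k * L), n - min n (k * L), by omega, by omega, by omega⟩
    exact (palLength_factorAt_add_le u i a b).trans (add_le_add (ih i a ha) (h _ b hb))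

theorem palindrome_factorAt {A : Type*} {u : ℕ → A} {i n : ℕ}
    (h : ∀ j < n, u (i + (n - 1 - j)) = u (i + j)) : (factorAt u i n).Palindrome := by
  apply List.Palindrome.of_reverse_eq
  apply List.ext_getElem
  · simp
  · intro j h1 h2
    have hj : j < n := by simpa [length_factorAt] using h2
    simpa [factorAt] using h j hj

/-! ### Windows on which the slope is nearly rational -/

theorem neg_sub_one_add_mul_ediv {q : ℤ} (hq : 0 < q) (x m : ℤ) :
    (-x - 1 + q * m) / q = m - 1 - x / q := by
  rw [Int.add_mul_ediv_left _ _ hq.ne']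
  have : (-x - 1) / q = -1 - x / q := by
    have h1 := Int.emod_add_mul_ediv x q
    have h2 := Int.emod_nonneg x hq.ne'
    have h3 := Int.emod_lt_of_pos x hq
    rw [Int.ediv_eq_iff_of_pos hq]
    constructor <;> nlinarith
  omega

/-- Where the integer parts of `i α` follow an arithmetic progression divided by `q`, the word is
`q`-periodic with a centre of symmetry in each period, so a factor is a palindrome followed by
fewer than `q` letters. -/
theorem palLength_factorAt_le_of_floor_eq_ediv {α : ℝ} (h0 : 0 < α) (h1 : α < 1) {q : ℕ} {p : ℤ}
    (hq : 0 < q) (hpq : IsCoprime p q) {D : ℕ}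
    (hD : ∀ i n, n ≤ q → palLength (factorAt (mechanicalWord α) i n) ≤ D) {i N : ℕ} {c : ℤ}
    (h : ∀ j : ℕ, j ≤ N → ⌊((i + j : ℕ) : ℝ) * α⌋ = (c + j * p) / q) :
    palLength (factorAt (mechanicalWord α) i N) ≤ D + 1 := by
  rcases le_total N q with hN | hN
  · exact (hD i N hN).trans (Nat.le_succ D)
  have hq' : (0 : ℤ) < q := by exact_mod_cast hq
  -- The prefix of length `n` is symmetric as soon as `q` divides `2 c + n p + 1`.
  obtain ⟨n, r, rfl, hr, m, hm⟩ : ∃ n r : ℕ, N = n + r ∧ r ≤ q ∧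
      ∃ m : ℤ, 2 * c + n * p + 1 = q * m := by
    obtain ⟨a, b, hab⟩ := hpq
    set x : ℤ := -(2 * c + 1) * a with hx
    have hr0 := Int.emod_nonneg ((N : ℤ) - x) hq'.ne'
    have hr1 := Int.emod_lt_of_pos ((N : ℤ) - x) hq'
    have hr2 := Int.emod_add_mul_ediv ((N : ℤ) - x) q
    obtain ⟨r, hr⟩ := Int.eq_ofNat_of_zero_le hr0
    rw [hr] at hr1 hr2
    refine ⟨N - r, r, by omega, by omega, (2 * c + 1) * b + (((N : ℤ) - x) / q) * p, ?_⟩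
    have e : ((N - r : ℕ) : ℤ) = x + q * (((N : ℤ) - x) / q) := by
      rw [Nat.cast_sub (by omega)]
      linarith
    rw [e]
    linear_combination (-(2 * c + 1)) * hab + p * hx
  have hpal : (factorAt (mechanicalWord α) i n).Palindrome := by
    apply palindrome_factorAt
    intro j hj
    apply mechanicalWord_eq_of_increment_eq h0 h1
    have a1 := h (n - 1 - j + 1) (by omega)
    have a2 := h (n - 1 - j) (by omega)
    have a3 := h (j + 1) (by omega)
    have a4 := h j (by omega)
    have e1 : c + ((n - 1 - j + 1 : ℕ) : ℤ) * p = -(c + j * p) - 1 + q * m := by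
      have : n - 1 - j + 1 = n - j := by omega
      rw [this, Nat.cast_sub hj.le]
      linear_combination hm
    have e2 : c + ((n - 1 - j : ℕ) : ℤ) * p = -(c + ((j + 1 : ℕ) : ℤ) * p) - 1 + q * m := by
      have : n - 1 - j = n - (j + 1) := by omega
      rw [this, Nat.cast_sub hj]
      linear_combination hm
    rw [e1, neg_sub_one_add_mul_ediv hq'] at a1
    rw [e2, neg_sub_one_add_mul_ediv hq'] at a2
    rw [add_assoc, add_assoc, a1, a2, a3, a4]
    omega
  calc _ ≤ _ := palLength_factorAt_add_le _ i n r
    _ ≤ 1 + D := add_le_add (palLength_le_one_of_palindrome hpal) (hD _ r hr)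
    _ = D + 1 := add_comm _ _

/-- A monotone integer sequence rising by at most one on `[0, N]` has at most one jump there. -/
theorem exists_single_jump {c : ℕ → ℤ} (hc : Monotone c) {N : ℕ} (hN : c N ≤ c 0 + 1) :
    ∃ J, (∀ j ≤ N, j < J → c j = c 0) ∧ ∀ j ≤ N, J ≤ j → c j = c 0 + 1 := by
  classical
  by_cases hex : ∃ J, c 0 < c J
  · refine ⟨Nat.find hex, fun j hj hJ => ?_, fun j hj hJ => ?_⟩
    · have := Nat.find_min hex hJ
      have := hc (Nat.zero_le j)
      omega
    · have := Nat.find_spec hex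
      have := hc hJ
      have := hc hj
      omega
  · push Not at hex
    refine ⟨N + 1, fun j hj hJ => le_antisymm (hex j) (hc (Nat.zero_le j)), fun j hj hJ => ?_⟩
    omega

/-- If `α` exceeds `p / q` by `ε`, then on a window of length `N ≤ 1 / (q ε)` the word coincides
with a periodic word of slope `p / q`, up to one change of phase. -/
theorem palLength_factorAt_le_of_approx {α : ℝ} (h0 : 0 < α) (h1 : α < 1) {q : ℕ} {p : ℤ}
    (hq : 0 < q) (hpq : IsCoprime p q) {ε : ℝ} (hε : 0 ≤ ε) (hα : α = p / q + ε) {D : ℕ}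
    (hD : ∀ i n, n ≤ q → palLength (factorAt (mechanicalWord α) i n) ≤ D) {N : ℕ}
    (hN : N * (q * ε) ≤ 1) (i : ℕ) :
    palLength (factorAt (mechanicalWord α) i N) ≤ 2 * D + 3 := by
  have hq' : (0 : ℝ) < q := by exact_mod_cast hq
  let c : ℕ → ℤ := fun j => ⌊q * (i * α) + j * (q * ε)⌋
  have hqε : 0 ≤ q * ε := mul_nonneg hq'.le hε
  have hmono : Monotone c := by
    intro j k hjk
    apply Int.floor_le_floor
    have : (j : ℝ) ≤ k := by exact_mod_cast hjk
    nlinarith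
  have hcN : c N ≤ c 0 + 1 := by
    simp only [c]
    rw [← Int.floor_add_one]
    apply Int.floor_le_floor
    push_cast
    linarith
  have hfloor : ∀ j : ℕ, ⌊((i + j : ℕ) : ℝ) * α⌋ = (c j + j * p) / q := by
    intro j
    have e : ((i + j : ℕ) : ℝ) * α = (q * (i * α) + j * (q * ε) + ((j * p : ℤ) : ℝ)) / q := by
      push_cast
      rw [eq_div_iff hq'.ne']
      have : α * q = p + q * ε := by rw [hα]; field_simp
      linear_combination (j : ℝ) * this
    rw [e, Int.floor_div_natCast, Int.floor_add_intCast]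
  obtain ⟨J, hJ1, hJ2⟩ := exists_single_jump hmono hcN
  rcases lt_or_ge N J with hJ | hJ
  · have := palLength_factorAt_le_of_floor_eq_ediv h0 h1 hq hpq hD (i := i) (N := N) (c := c 0)
      fun j hj => by rw [hfloor, hJ1 j hj (by omega)]
    omega
  have h2 := palLength_factorAt_le_of_floor_eq_ediv h0 h1 hq hpq hD (i := i + J) (N := N - J)
    (c := c 0 + 1 + J * p) fun j hj => by
      rw [add_assoc, hfloor, hJ2 (J + j) (by omega) (by omega)]
      congr 1
      push_cast
      ring
  rcases Nat.eq_zero_or_pos J with rfl | hJ0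
  · simp only [Nat.sub_zero, add_zero] at h2
    omega
  have h3 := palLength_factorAt_le_of_floor_eq_ediv h0 h1 hq hpq hD (i := i) (N := J - 1)
    (c := c 0) fun j hj => by rw [hfloor, hJ1 j (by omega) (by omega)]
  -- The letter at `J - 1` straddles the change of phase.
  have h4 := palLength_factorAt_le (mechanicalWord α) (i + (J - 1)) 1
  have h5 := palLength_factorAt_add_le (mechanicalWord α) i (J - 1) 1
  have h6 := palLength_factorAt_add_le (mechanicalWord α) i J (N - J)
  rw [Nat.sub_add_cancel hJ0] at h5
  rw [Nat.add_sub_cancel' hJ] at h6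
  omega

/-! ### Slopes with prescribed approximations -/

/-- A Liouville-type slope: the partial sums `p n / b n` of a series of reciprocals, with
approximation quality `Q n` at least `G n (b n)`, so chosen after `b n`. -/
theorem exists_fast_approximable_slope (G : ℕ → ℕ → ℕ) :
    ∃ (α : ℝ) (b Q : ℕ → ℕ) (p : ℕ → ℤ), Irrational α ∧ 0 < α ∧ α < 1 ∧ Monotone Q ∧
      ∀ n, 0 < b n ∧ IsCoprime (p n) (b n : ℤ) ∧ b (n + 1) = 2 * b n * Q n ∧ G n (b n) ≤ Q n ∧
        n < Q n ∧ (p n : ℝ) / b n ≤ α ∧ α ≤ p n / b n + 1 / (b n * Q n) := by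
  let t : ℕ → ℕ → ℕ := fun n x => max (G n x) (n + 1)
  obtain ⟨b, hb0, hb'⟩ : ∃ b : ℕ → ℕ, b 0 = 2 ∧ ∀ n, b (n + 1) = 2 * b n * (b n * t n (b n)) :=
    ⟨fun n => Nat.rec 2 (fun n x => 2 * x * (x * t n x)) n, rfl, fun _ => rfl⟩
  let Q : ℕ → ℕ := fun n => b n * t n (b n)
  obtain ⟨p, hp0, hp'⟩ : ∃ p : ℕ → ℤ, p 0 = 1 ∧ ∀ n, p (n + 1) = 2 * Q n * p n + 1 :=
    ⟨fun n => Nat.rec 1 (fun n y => 2 * Q n * y + 1) n, rfl, fun _ => rfl⟩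
  replace hb' : ∀ n, b (n + 1) = 2 * b n * Q n := hb'
  have ht : ∀ n x, n < t n x := fun n x => lt_of_lt_of_le n.lt_succ_self (le_max_right _ _)
  have hb : ∀ n, 0 < b n := by
    intro n
    induction n with
    | zero => exact hb0 ▸ two_pos
    | succ n ih =>
      rw [hb']
      exact Nat.mul_pos (Nat.mul_pos two_pos ih)
        (Nat.mul_pos ih ((Nat.zero_le n).trans_lt (ht _ _)))
  have hQt : ∀ n, t n (b n) ≤ Q n := fun n => Nat.le_mul_of_pos_left _ (hb n)
  have hQ : ∀ n, n < Q n := fun n => (ht _ _).trans_le (hQt n)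
  have hQb : ∀ n, b n ≤ Q n := fun n =>
    Nat.le_mul_of_pos_right _ ((Nat.zero_le n).trans_lt (ht _ _))
  have hmono : Monotone Q := by
    refine monotone_nat_of_le_succ fun n => le_trans ?_ (hQb (n + 1))
    rw [hb']
    exact (Nat.le_mul_of_pos_left (Q n) (Nat.mul_pos two_pos (hb n)))
  -- Each prime factor of `b (n + 1)` divides `2 * Q n`, because `b n` divides `Q n`.
  have hcop : ∀ n, IsCoprime (p n) (b n : ℤ) := by
    intro n
    cases n with
    | zero => exact hp0 ▸ isCoprime_one_left
    | succ n =>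
      have h1 : IsCoprime (p (n + 1)) (2 * Q n : ℤ) := ⟨1, -p n, by rw [hp']; ring⟩
      have hd : (b n : ℤ) ∣ Q n := Int.natCast_dvd_natCast.2 (Nat.dvd_mul_right _ _)
      have h2 : IsCoprime (p (n + 1)) (b n : ℤ) :=
        h1.of_isCoprime_of_dvd_right (hd.mul_left 2)
      have e : ((b (n + 1) : ℕ) : ℤ) = 2 * Q n * b n := by
        rw [hb']
        push_cast
        ring
      rw [e]
      exact h1.mul_right h2
  have hbR : ∀ n, (0 : ℝ) < b n := fun n => by exact_mod_cast hb n
  have hQR : ∀ n, (1 : ℝ) ≤ Q n := fun n => by exact_mod_cast (Nat.zero_le n).trans_lt (hQ n)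
  let lo : ℕ → ℝ := fun n => p n / b n
  let hi : ℕ → ℝ := fun n => p n / b n + 1 / (b n * Q n)
  have hstep : ∀ n, lo (n + 1) = lo n + 1 / (2 * (b n * Q n)) := by
    intro n
    have := (hbR n).ne'
    have := (zero_lt_one.trans_le (hQR n)).ne'
    simp only [lo, hb', hp']
    push_cast
    field_simp
  have hpos : ∀ n, 0 < 1 / ((b n : ℝ) * Q n) := fun n =>
    one_div_pos.2 (mul_pos (hbR n) (zero_lt_one.trans_le (hQR n)))
  have hhalf : ∀ n, 1 / (2 * ((b n : ℝ) * Q n)) = 1 / ((b n : ℝ) * Q n) / 2 := fun n => by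
    rw [one_div, mul_inv, one_div]
    ring
  have hlo : ∀ n, lo n < lo (n + 1) := fun n => by
    rw [hstep, hhalf]
    linarith [hpos n]
  have hhi : Antitone hi := by
    refine antitone_nat_of_succ_le fun n => ?_
    have e : hi (n + 1) = lo (n + 1) + 1 / (b (n + 1) * Q (n + 1)) := rfl
    have h1 : 1 / ((b (n + 1) : ℝ) * Q (n + 1)) ≤ 1 / (2 * ((b n : ℝ) * Q n)) := by
      have h2 : (0 : ℝ) < b n * Q n := one_div_pos.1 (hpos n)
      apply one_div_le_one_div_of_le (by positivity)
      rw [hb']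
      push_cast
      nlinarith [hQR (n + 1)]
    have e' : hi n = lo n + 1 / (b n * Q n) := rfl
    rw [e, e', hstep]
    rw [hhalf] at h1 ⊢
    linarith
  have hmem := Set.mem_iInter.1 <| Monotone.ciSup_mem_iInter_Icc_of_antitone
    (monotone_nat_of_le_succ fun n => (hlo n).le) hhi fun n => by
      change lo n ≤ lo n + 1 / (b n * Q n)
      linarith [hpos n]
  generalize (⨆ n, lo n) = α at hmem
  have h0 := hmem 0
  have e0 : lo 0 = 1 / 2 := by simp [lo, hp0, hb0]
  have e1 : hi 0 ≤ 3 / 4 := by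
    have e : hi 0 = lo 0 + 1 / ((2 : ℕ) * Q 0) := by simp only [hi, lo, hb0]
    have h2 : (2 : ℝ) ≤ Q 0 := by exact_mod_cast hb0 ▸ hQb 0
    have h3 : 1 / (((2 : ℕ) : ℝ) * Q 0) ≤ 1 / 4 :=
      one_div_le_one_div_of_le (by norm_num) (by push_cast; linarith)
    rw [e, e0]
    linarith
  refine ⟨α, b, Q, p, ?_, by linarith [h0.1], by linarith [h0.2], hmono, fun n =>
    ⟨hb n, hcop n, hb' n, (le_max_left _ _).trans (hQt n), hQ n, (hmem n).1, (hmem n).2⟩⟩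
  -- If `α = r / s`, then `s (b n α - p n)` is an integer in `(0, 1)` for `n = s`.
  rintro ⟨x, hx⟩
  have hs : (0 : ℝ) < x.den := by exact_mod_cast x.den_pos
  have hxα : α * x.den = x.num := by
    rw [← hx]
    exact_mod_cast Rat.mul_den_eq_num x
  set n := x.den with hn
  have hQn : (n : ℝ) < Q n := by exact_mod_cast hQ n
  have g1 : (p n : ℝ) / b n < α := (hlo n).trans_le (hmem (n + 1)).1
  have g2 : α ≤ p n / b n + 1 / (b n * Q n) := (hmem n).2
  have k1 : (p n : ℝ) * n < x.num * b n := by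
    rw [div_lt_iff₀ (hbR n)] at g1
    rw [← hxα]
    nlinarith
  have k2 : (x.num : ℝ) * b n < p n * n + 1 := by
    have q0 := zero_lt_one.trans_le (hQR n)
    have e : (p n : ℝ) / b n + 1 / (b n * Q n) = (p n + 1 / Q n) / b n := by
      have := (hbR n).ne'
      field_simp
    rw [e, le_div_iff₀ (hbR n)] at g2
    have h3 : 1 / (Q n : ℝ) * n < 1 := by
      rw [one_div, inv_mul_lt_iff₀ q0]
      linarith
    rw [← hxα]
    nlinarith
  have k1' : p n * n < x.num * b n := by exact_mod_cast k1
  have k2' : x.num * b n < p n * n + 1 := by exact_mod_cast k2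
  omega

/-! ### Slow growth of the palindromic length -/

theorem PL_le_of_forall {A : Type*} {u : ℕ → A} {n D : ℕ}
    (h : ∀ i, palLength (factorAt u i n) ≤ D) : PL u n ≤ D := by
  obtain ⟨_, ⟨i, rfl⟩, hv⟩ := (isGreatest_PL u n).1
  exact hv ▸ h i

theorem theorem1 (f : ℕ → ℝ) (hmono : Monotone f) (hlim : Tendsto f atTop atTop) :
    ∃ u : ℕ → Fin 2, IsSturmian u ∧ (fun n => (PL u n : ℝ)) =o[atTop] f := by
  -- `E (b n)` will bound the palindromic length of all factors of length at most `Q (n + 1)`.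
  let E : ℕ → ℕ := fun b => 2 * (2 * b * (2 * b + 3)) + 3
  have hG : ∀ n b : ℕ, ∃ N : ℕ, ((n + 1 : ℕ) : ℝ) * E b ≤ f N := fun n b =>
    (hlim.eventually_ge_atTop _).exists
  choose G hG using hG
  obtain ⟨α, b, Q, p, hα, h0, h1, hQmono, H⟩ := exists_fast_approximable_slope G
  refine ⟨mechanicalWord α, isSturmian_mechanicalWord hα h0 h1, ?_⟩
  have hwindow : ∀ n D : ℕ,
      (∀ i m, m ≤ b n → palLength (factorAt (mechanicalWord α) i m) ≤ D) →
      ∀ i m, m ≤ Q n → palLength (factorAt (mechanicalWord α) i m) ≤ 2 * D + 3 := by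
    intro n D hD i m hm
    obtain ⟨hb, hcop, -, -, hQ, hlo, hhi⟩ := H n
    have hbR : (0 : ℝ) < b n := by exact_mod_cast hb
    have hQR : (0 : ℝ) < Q n := by exact_mod_cast (Nat.zero_le n).trans_lt hQ
    refine palLength_factorAt_le_of_approx h0 h1 hb hcop (ε := α - p n / b n) (by linarith)
      (by ring) hD ?_ i
    have hmR : (m : ℝ) ≤ Q n := by exact_mod_cast hm
    calc (m : ℝ) * (b n * (α - p n / b n)) ≤ Q n * (b n * (1 / (b n * Q n))) := by
          gcongr
          linarith
      _ = 1 := by field_simp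
  have hbound : ∀ n N : ℕ, N ≤ Q (n + 1) → PL (mechanicalWord α) N ≤ E (b n) := by
    intro n N hN
    refine PL_le_of_forall fun i => hwindow (n + 1) _ ?_ i N hN
    rw [(H n).2.2.1]
    exact palLength_factorAt_le_mul
      (hwindow n (b n) fun i m hm => (palLength_factorAt_le _ i m).trans hm) _
  rw [isLittleO_iff]
  intro c hc
  obtain ⟨n, hn⟩ := exists_nat_one_div_lt hc
  filter_upwards [eventually_gt_atTop (Q n)] with N hN
  have hex : ∃ m, N ≤ Q m := ⟨N, (H N).2.2.2.2.1.le⟩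
  obtain ⟨k, hk⟩ : ∃ k, Nat.find hex = k + 1 := by
    refine Nat.exists_eq_succ_of_ne_zero fun h => ?_
    have := Nat.find_spec hex
    rw [h] at this
    exact absurd (this.trans (hQmono (Nat.zero_le n))) (not_le.2 hN)
  have hNk : N ≤ Q (k + 1) := hk ▸ Nat.find_spec hex
  have hkN : Q k < N := not_le.1 (Nat.find_min hex (by omega))
  have hnk : n ≤ k := by
    by_contra! h
    exact absurd (hNk.trans (hQmono h)) (not_le.2 hN)
  have hPL : (PL (mechanicalWord α) N : ℝ) ≤ E (b k) := by exact_mod_cast hbound k N hNk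
  have hf : ((k + 1 : ℕ) : ℝ) * E (b k) ≤ f N :=
    (hG k (b k)).trans (hmono (((H k).2.2.2.1).trans hkN.le))
  have hck : 1 ≤ c * ((k + 1 : ℕ) : ℝ) := by
    rw [div_lt_iff₀ (by positivity)] at hn
    have : (n : ℝ) ≤ k := by exact_mod_cast hnk
    push_cast
    nlinarith
  rw [Real.norm_of_nonneg (Nat.cast_nonneg _)]
  calc (PL (mechanicalWord α) N : ℝ) ≤ E (b k) := hPL
    _ ≤ c * ((k + 1 : ℕ) : ℝ) * E (b k) := le_mul_of_one_le_left (Nat.cast_nonneg _) hck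
    _ = c * (((k + 1 : ℕ) : ℝ) * E (b k)) := mul_assoc _ _ _
    _ ≤ c * ‖f N‖ := by
      gcongr
      exact hf.trans (Real.le_norm_self _)
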